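/- Let $n,d$ be natural numbers. Let $G$ be a directed graph on the tokens $[n]=\{1,\dots,n\}$, and write $j\in Ne(i)$ if token $i$ attends to token $j$. Assume that (1) every token attends to itself, $k\in Ne(k)$ for all $k\in[n]$, and (2) $G$ is (strongly) connected and has a Hamiltonian path: there is a permutation $\gamma$ of $[n]$ with $\gamma(i)\in Ne(\gamma(i+1))$ for all $1\le i\le n-1$. Fix a teleport probability $0<\alpha<1$, a number $K\ge 1$ of diffusion steps, a number $h\ge1$ of heads, a head size $m\ge1$ and a hidden width $r\ge1$. For $X=[X_1,\dots,X_n]\in\mathbb R^{d\times n}$, a head with parameters $W_Q,W_K,W_V\in\mathbb R^{m\times d}$ has the sparse attention weights $$A_{ij}=\frac{\exp\big((W_KX_j)^{\top}W_QX_i\big)}{\sum_{l\in Ne(i)}\exp\big((W_KX_l)^{\top}W_QX_i\big)}\quad(j\in Ne(i)),\qquad A_{ij}=0\quad(j\notin Ne(i)),$$ and its output is $Z^{(K)}\in\mathbb R^{m\times n}$, where $$Z^{(0)}_i=W_VX_i,\qquad Z^{(k+1)}_i=(1-\alpha)\sum_{j\in Ne(i)}A_{ij}Z^{(k)}_j+\alpha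 Z^{(0)}_i .$$ A Diffuser layer maps $X$ to $Y+W_2\,\mathrm{ReLU}(W_1Y+b_1\mathbf 1^{\top})+b_2\mathbf 1^{\top}$, where $Y=X+W_O\,[\,\mathrm{head}^1(X);\dots;\mathrm{head}^h(X)\,]$ is formed from $h$ such heads stacked vertically, with $W_O\in\mathbb R^{d\times hm}$, $W_1\in\mathbb R^{r\times d}$, $W_2\in\mathbb R^{d\times r}$, $b_1\in\mathbb R^r$, $b_2\in\mathbb R^d$. Let $\mathcal D^{h,m,r}$ be the class of functions $X\mapsto T(X+E)$, where $E\in\mathbb R^{d\times n}$ (positional embedding) and $T$ is a composition of finitely many Diffuser layers, all with the given $G,\alpha,K$. Then for every compact $\mathbb D\subset\mathbb R^{d\times n}$, every continuous $f:\mathbb D\to\mathbb R^{d\times n}$, every $1\le q<\infty$ and every $\varepsilon>0$ there is $g\in\mathcal D^{h,m,r}$ with $$d_q(f,g):=\Big(\int_{\mathbb D}\|f(X)-g(X)\|_q^q\,dX\Big)^{1/q}\le\varepsilon,$$ where $\|\cdot\|_q$ is the entrywise $\ell_q$ norm and $dX$ is Lebesgue measure. -/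

import Mathlib

noncomputable section

namespace Diffuser

/-- `Ne(i)`: the tokens to which token `i` attends in the attention graph `G`
(`G.Adj i j` means that query `i` attends to key `j`). -/
def neighbors {n : ℕ} (G : Digraph (Fin n)) (i : Fin n) : Finset (Fin n) :=
  open Classical in Finset.univ.filter (fun j => G.Adj i j)

/-- The condition on the sparsity pattern: every token attends to itself, the directed attention
graph is (strongly) connected, and it has a Hamiltonian path `γ 0, γ 1, …, γ (n-1)` in which each
token is attended to by the next one. -/
structure SparsityCondition {n : ℕ} (G : Digraph (Fin n)) : Prop where
  self_attends : ∀ k, k ∈ neighbors G k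
  connected : ∀ i j, Relation.ReflTransGen G.Adj i j
  hamiltonian : ∃ γ : Equiv.Perm (Fin n), ∀ (i : ℕ) (hi : i + 1 < n),
    γ ⟨i, Nat.lt_of_succ_lt hi⟩ ∈ neighbors G (γ ⟨i + 1, hi⟩)

/-- The parameters of one attention head of head size `m` on `d`-dimensional tokens. -/
structure HeadParams (d m : ℕ) where
  WQ : Matrix (Fin m) (Fin d) ℝ
  WK : Matrix (Fin m) (Fin d) ℝ
  WV : Matrix (Fin m) (Fin d) ℝ

/-- The sparse attention matrix of a head: row `i` is the softmax, over the keys `j ∈ Ne(i)`, of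
the scores `⟨W_K X_j, W_Q X_i⟩`, and is zero outside `Ne(i)`. -/
def HeadParams.attention {n d m : ℕ} (H : HeadParams d m) (G : Digraph (Fin n))
    (X : Matrix (Fin d) (Fin n) ℝ) : Matrix (Fin n) (Fin n) ℝ :=
  open Classical in
  let S : Matrix (Fin n) (Fin n) ℝ := (H.WK * X).transpose * (H.WQ * X)
  Matrix.of fun i j =>
    if j ∈ neighbors G i then Real.exp (S j i) / ∑ l ∈ neighbors G i, Real.exp (S l i) else 0

/-- The diffusion iterates `Z^(k)`, with teleport probability `α`:
`Z^(0) = W_V X` and `Z^(k+1)_i = (1 - α) ∑_{j ∈ Ne(i)} A_{ij} Z^(k)_j + α Z^(0)_i`. -/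
def HeadParams.diffusion {n d m : ℕ} (H : HeadParams d m) (G : Digraph (Fin n)) (α : ℝ)
    (X : Matrix (Fin d) (Fin n) ℝ) : ℕ → Matrix (Fin m) (Fin n) ℝ
  | 0 => H.WV * X
  | k + 1 => (1 - α) • (H.diffusion G α X k * (H.attention G X).transpose) + α • (H.WV * X)

/-- The parameters of one layer with `h` heads of size `m` and a feed-forward part with hidden
width `r`. The columns of `WO` are indexed by pairs (head, coordinate of that head). -/
structure LayerParams (d h m r : ℕ) where
  heads : Fin h → HeadParams d m
  WO : Matrix (Fin d) (Fin h × Fin m) ℝ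
  W1 : Matrix (Fin r) (Fin d) ℝ
  b1 : Fin r → ℝ
  W2 : Matrix (Fin d) (Fin r) ℝ
  b2 : Fin d → ℝ

/-- The attention part of a layer, with `K` diffusion steps and a residual connection. -/
def LayerParams.attn {n d h m r : ℕ} (L : LayerParams d h m r) (G : Digraph (Fin n)) (α : ℝ)
    (K : ℕ) (X : Matrix (Fin d) (Fin n) ℝ) : Matrix (Fin d) (Fin n) ℝ :=
  X + L.WO * Matrix.of fun (p : Fin h × Fin m) (i : Fin n) => (L.heads p.1).diffusion G α X K p.2 i

/-- The token-wise feed-forward part `Y + W₂ · ReLU(W₁ Y + b₁ 1ᵀ) + b₂ 1ᵀ` of a layer. -/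
def LayerParams.feedForward {n d h m r : ℕ} (L : LayerParams d h m r)
    (Y : Matrix (Fin d) (Fin n) ℝ) : Matrix (Fin d) (Fin n) ℝ :=
  Y + L.W2 * (Matrix.of fun (s : Fin r) (i : Fin n) => max 0 ((L.W1 * Y) s i + L.b1 s))
    + Matrix.of fun (s : Fin d) (_ : Fin n) => L.b2 s

/-- One Diffuser layer. -/
def LayerParams.apply {n d h m r : ℕ} (L : LayerParams d h m r) (G : Digraph (Fin n)) (α : ℝ)
    (K : ℕ) (X : Matrix (Fin d) (Fin n) ℝ) : Matrix (Fin d) (Fin n) ℝ :=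
  L.feedForward (L.attn G α K X)

/-- The function of a stack of layers; the head of the list acts first. -/
def runLayers {n d h m r : ℕ} (G : Digraph (Fin n)) (α : ℝ) (K : ℕ)
    (Ls : List (LayerParams d h m r)) (X : Matrix (Fin d) (Fin n) ℝ) : Matrix (Fin d) (Fin n) ℝ :=
  Ls.foldl (fun Y L => L.apply G α K Y) X

/-- The class of Diffuser networks with `h` heads of size `m` and hidden width `r`, on the attention
graph `G`, with teleport probability `α` and `K` diffusion steps per layer: a positional embedding
`E` is added to the input, and finitely many layers are applied. -/
def networks {n : ℕ} (G : Digraph (Fin n)) (α : ℝ) (K d h m r : ℕ) :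
    Set (Matrix (Fin d) (Fin n) ℝ → Matrix (Fin d) (Fin n) ℝ) :=
  {g | ∃ (E : Matrix (Fin d) (Fin n) ℝ) (Ls : List (LayerParams d h m r)),
    ∀ X, g X = runLayers G α K Ls (X + E)}

/-- `d_q(f, g) = (∫_D ‖f(X) - g(X)‖_q^q dX)^{1/q}`, with the entrywise `ℓ_q` norm and Lebesgue
measure on `ℝ^{d × n}`; it takes values in `[0, ∞]`. -/
def dist {n d : ℕ} (D : Set (Matrix (Fin d) (Fin n) ℝ)) (q : ℝ)
    (f g : Matrix (Fin d) (Fin n) ℝ → Matrix (Fin d) (Fin n) ℝ) : ENNReal :=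
  (∫⁻ X : Fin d → Fin n → ℝ in Matrix.of ⁻¹' D,
    ∑ s, ∑ i, ENNReal.ofReal (|f (Matrix.of X) s i - g (Matrix.of X) s i| ^ q)) ^ (1 / q)

end Diffuser

end

noncomputable section

namespace Diffuser

open Filter Topology MeasureTheory

/-! Heads with zero query and key matrices attend uniformly, so their diffusion applies a fixed
row-stochastic matrix `B`, with positive diagonal and positive weight on every edge of `G`. Two
kinds of layer then suffice: a single token-wise ReLU neuron, and the addition of the `B`-averages
of one row `s₀` to that row (`MixNet.exists_layers`).

Such networks fit arbitrary targets on a finite set of inputs, provided tokens at different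
positions never coincide, even across inputs (`MixNet.exists_interpolate`). A generic linear
functional encodes each token in row `s₀`. A generic recoding followed by mixing makes each code
remember its neighbours' codes; by strong connectivity, finitely many rounds make it determine its
position and the whole input (`MixNet.exists_contextual`). Scalar interpolation by one-neuron
residual layers (`LineNet.exists_interpolate`) and piecewise linear shifts then write the targets.

For continuous `f`, the positional embedding moves the tokens into disjoint intervals, a
one-dimensional network contracts most of each grid cell towards its corner, and the corners are
sent to sampled values of `f`. Clipping bounds the error on the remaining set, whose measure is
small (`MixNet.exists_approx`). -/

/-! ### Residual one-neuron networks on the line. -/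

/-- The maps of the real line generated by residual one-neuron ReLU layers. -/
inductive LineNet : (ℝ → ℝ) → Prop
  | id : LineNet fun x => x
  | step {φ : ℝ → ℝ} (hφ : LineNet φ) (v u b c : ℝ) :
      LineNet fun x => φ x + v * max 0 (u * φ x + b) + c

namespace LineNet

theorem comp {ψ φ : ℝ → ℝ} (hψ : LineNet ψ) (hφ : LineNet φ) : LineNet fun x => ψ (φ x) := by
  induction hψ with
  | id => exact hφ
  | step _ v u b c ih => exact ih.step v u b c

theorem neuron (v u b : ℝ) : LineNet fun x => x + v * max 0 (u * x + b) := by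
  simpa using LineNet.id.step v u b 0

/-- A map squeezing `[a, a + l]` into `[a, a + δ]` and fixing everything outside `[a, a + w]`. -/
theorem exists_squeeze (a : ℝ) {l w δ : ℝ} (hl : 0 < l) (hlw : l < w) (hδ : 0 < δ) :
    ∃ ψ, LineNet ψ ∧ (∀ x ≤ a, ψ x = x) ∧ (∀ x, a + w ≤ x → ψ x = x) ∧
      ∀ x, a ≤ x → x ≤ a + l → a ≤ ψ x ∧ ψ x ≤ a + δ := by
  obtain ⟨ρ, hρ0, hρ1, hρδ⟩ : ∃ ρ : ℝ, 0 < ρ ∧ ρ < 1 ∧ ρ * l ≤ δ := by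
    refine ⟨min (1 / 2) (δ / l), by positivity, (min_le_left _ _).trans_lt (by norm_num), ?_⟩
    calc min (1 / 2) (δ / l) * l ≤ δ / l * l := by gcongr; exact min_le_right _ _
      _ = δ := by field_simp
  have hwl : 0 < w - l := by linarith
  have hρl : ρ * l < w := by nlinarith
  obtain ⟨σ, hσ⟩ : ∃ σ : ℝ, σ = (w - ρ * l) / (w - l) := ⟨_, rfl⟩
  have hσ0 : 0 < σ := by rw [hσ]; exact div_pos (by linarith) hwl
  have hσw : σ * (w - l) = w - ρ * l := by rw [hσ]; field_simp
  -- Each neuron bends the output of the previous one. The successive slopes are `ρ` after `a`, `σ`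
  -- after `a + l`, and 1 after `a + w`; `σ` is the slope that returns the graph to the diagonal at
  -- `a + w`.
  refine ⟨_, (neuron (1 / σ - 1) 1 (-(a + w))).comp ((neuron (σ / ρ - 1) 1 (-(a + ρ * l))).comp
    (neuron (ρ - 1) 1 (-a))), ?_, ?_, ?_⟩
  · intro x hx
    have h1 : max 0 (1 * x + -a) = 0 := max_eq_left (by linarith)
    have h2 : max 0 (1 * x + -(a + ρ * l)) = 0 := max_eq_left (by nlinarith)
    have h3 : max 0 (1 * x + -(a + w)) = 0 := max_eq_left (by linarith)
    simp only [h1, h2, h3, mul_zero, add_zero]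
  · intro x hx
    have h1 : max 0 (1 * x + -a) = x - a := by rw [max_eq_right (by linarith)]; ring
    have h2 : max 0 (1 * (x + (ρ - 1) * (x - a)) + -(a + ρ * l)) = ρ * (x - a - l) := by
      have : 0 ≤ ρ * (x - a - l) := mul_nonneg hρ0.le (by linarith)
      rw [max_eq_right (by linarith)]; ring
    have h3 : x + (ρ - 1) * (x - a) + (σ / ρ - 1) * (ρ * (x - a - l))
        = a + w + σ * (x - a - w) := by
      have : σ / ρ * ρ = σ := by field_simp
      linear_combination (x - a - l) * this + hσw
    have h4 : max 0 (1 * (a + w + σ * (x - a - w)) + -(a + w)) = σ * (x - a - w) := by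
      have : 0 ≤ σ * (x - a - w) := mul_nonneg hσ0.le (by linarith)
      rw [max_eq_right (by linarith)]; ring
    simp only [h1, h2, h3, h4]
    field_simp
    ring
  · intro x hx hx'
    have h1 : max 0 (1 * x + -a) = x - a := by rw [max_eq_right (by linarith)]; ring
    have h5 : 0 ≤ ρ * (x - a) := mul_nonneg hρ0.le (by linarith)
    have h6 : ρ * (x - a) ≤ ρ * l := by gcongr; linarith
    have h2 : max 0 (1 * (x + (ρ - 1) * (x - a)) + -(a + ρ * l)) = 0 :=
      max_eq_left (by linarith)
    have h3 : max 0 (1 * (x + (ρ - 1) * (x - a) + (σ / ρ - 1) * 0) + -(a + w)) = 0 :=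
      max_eq_left (by linarith)
    simp only [h1, h2, h3]
    constructor <;> linarith

/-- Contraction of the first `M` intervals `[k w, k w + l]` of a grid of width `w`. -/
theorem exists_contract {l w δ : ℝ} (hl : 0 < l) (hlw : l < w) (hδ : 0 < δ) (M : ℕ) :
    ∃ φ, LineNet φ ∧ (∀ x, M * w ≤ x → φ x = x) ∧
      ∀ k < M, ∀ x, k * w ≤ x → x ≤ k * w + l → |φ x - k * w| ≤ δ := by
  induction M with
  | zero => exact ⟨_, .id, fun _ _ => rfl, by simp⟩
  | succ M ih =>
    obtain ⟨φ, hφ, hid, hc⟩ := ih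
    obtain ⟨ψ, hψ, h1, h2, h3⟩ := exists_squeeze (M * w) hl hlw hδ
    -- The rightmost interval is squeezed first: `ψ` fixes everything to its left, and its image
    -- lies where `φ` is the identity.
    refine ⟨_, hφ.comp hψ, fun x hx => ?_, fun k hk x hx hx' => ?_⟩
    · push_cast at hx
      rw [h2 x (by linarith), hid x (by nlinarith)]
    · rcases Nat.lt_succ_iff_lt_or_eq.1 hk with hk | rfl
      · have : (k + 1 : ℝ) ≤ M := by exact_mod_cast hk
        rw [h1 x (by nlinarith)]
        exact hc k hk x hx hx'
      · obtain ⟨h4, h5⟩ := h3 x hx hx'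
        rw [hid _ h4, abs_le]
        constructor <;> linarith

/-- Exact interpolation on a finite set of reals. -/
theorem exists_interpolate (Z : Finset ℝ) (g : ℝ → ℝ) :
    ∃ φ, LineNet φ ∧ (∀ z ∈ Z, φ z = g z) ∧ Tendsto (fun x => |φ x|) atBot atTop := by
  -- Each new point lies to the left of the old ones. Growth at `-∞` is carried along so that the
  -- next point can be sent to a value larger than all targets.
  induction Z using Finset.induction_on_min with
  | empty => exact ⟨_, .id, by simp, tendsto_abs_atBot_atTop⟩
  | insert z Z hz ih =>
    obtain ⟨φ, hφ, hg, hlim⟩ := ih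
    obtain ⟨C, hC⟩ : ∃ C, ∀ x ∈ insert z Z, |g x| < C := by
      obtain ⟨C, hC⟩ := ((insert z Z).image fun x => |g x|).exists_le
      exact ⟨C + 1, fun x hx => by
        linarith [hC _ (Finset.mem_image_of_mem (fun x => |g x|) hx)]⟩
    obtain ⟨τ, hzτ, hτ⟩ : ∃ τ, z < τ ∧ ∀ x ∈ Z, τ ≤ x := by
      rcases Z.eq_empty_or_nonempty with rfl | hne
      · exact ⟨z + 1, by linarith, by simp⟩
      · exact ⟨Z.min' hne, hz _ (Z.min'_mem hne), fun x hx => Z.min'_le x hx⟩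
    -- A neuron with kink at `τ` will move `z` to `y` and fix `Z`. As `|φ y|` exceeds every target,
    -- an output neuron with threshold `C` can then correct this value alone.
    obtain ⟨y, hyC, hyz⟩ := ((hlim.eventually_gt_atTop C).and (eventually_lt_atBot z)).exists
    have hw : 0 < (z - y) / (τ - z) := div_pos (by linarith) (by linarith)
    obtain ⟨ψ, hψ⟩ : ∃ ψ : ℝ → ℝ, ψ = fun x => x + -((z - y) / (τ - z)) * max 0 (-1 * x + τ) :=
      ⟨_, rfl⟩
    have hψN : LineNet ψ := hψ ▸ neuron _ _ _
    have hψZ : ∀ x ∈ Z, ψ x = x := fun x hx => by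
      have : max 0 (-1 * x + τ) = 0 := max_eq_left (by linarith [hτ x hx])
      simp only [hψ, this, mul_zero, add_zero]
    have hψz : ψ z = y := by
      have h1 : max 0 (-1 * z + τ) = τ - z := by rw [max_eq_right (by linarith)]; ring
      have h2 : τ - z ≠ 0 := by linarith
      rw [hψ]
      simp only [h1]
      field_simp
      ring
    have hψle : ∀ x, ψ x ≤ x := fun x => by
      have : 0 ≤ (z - y) / (τ - z) * max 0 (-1 * x + τ) := mul_nonneg hw.le (le_max_left _ _)
      simp only [hψ]
      linarith
    have hlim' : Tendsto (fun x => |φ (ψ x)|) atBot atTop :=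
      hlim.comp (tendsto_atBot_mono hψle tendsto_id)
    obtain ⟨σ, hσ, hσy⟩ : ∃ σ : ℝ, (σ = 1 ∨ σ = -1) ∧ σ * φ y = |φ y| := by
      rcases abs_choice (φ y) with h | h
      · exact ⟨1, .inl rfl, by rw [h]; ring⟩
      · exact ⟨-1, .inr rfl, by rw [h]; ring⟩
    have hσσ : σ * σ = 1 := by rcases hσ with rfl | rfl <;> norm_num
    have hσa : ∀ x, σ * x ≤ |x| := fun x => by
      rcases hσ with rfl | rfl
      · simpa using le_abs_self x
      · simpa using neg_abs_le x |> neg_le_neg |> fun h => by simpa using neg_le_abs x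
    obtain ⟨v, hv⟩ : ∃ v, v = (g z - φ y) / (|φ y| - C) := ⟨_, rfl⟩
    have hyC' : |φ y| - C ≠ 0 := by linarith
    have hv' : v * (|φ y| - C) = g z - φ y := by rw [hv]; field_simp
    -- If this slope vanished, the output neuron would flatten everything beyond the threshold to `σ
    -- * C`, forcing `|g z| = C`. Its being nonzero preserves growth at `-∞`.
    have hσv : σ + v ≠ 0 := fun h0 => by
      have h1 : g z = σ * C := by
        have : v = -σ := by linarith
        rw [this] at hv'
        linear_combination -hv' - φ y * hσσ + σ * hσy
      have h2 := hC z (Finset.mem_insert_self _ _)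
      have h3 := hσa (g z)
      have h4 : σ * g z = C := by rw [h1, ← mul_assoc, hσσ, one_mul]
      linarith
    obtain ⟨χ, hχ⟩ : ∃ χ : ℝ → ℝ, χ = fun x => x + v * max 0 (σ * x + -C) := ⟨_, rfl⟩
    have hχN : LineNet χ := hχ ▸ neuron _ _ _
    refine ⟨_, hχN.comp (hφ.comp hψN), fun x hx => ?_, ?_⟩
    · rcases Finset.mem_insert.1 hx with rfl | hxZ
      · rw [hψz]
        have : max 0 (σ * φ y + -C) = |φ y| - C := by rw [max_eq_right (by linarith), hσy]; ring
        simp only [hχ, this, hv']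
        ring
      · rw [hψZ x hxZ, hg x hxZ]
        have : max 0 (σ * g x + -C) = 0 := max_eq_left (by linarith [hC x hx, hσa (g x)])
        simp only [hχ, this]
        ring
    · have hχlim : Tendsto (fun t : ℝ => min t (|σ + v| * (t - C) - C)) atTop atTop := by
        refine tendsto_atTop.2 fun b => ?_
        have h1 : Tendsto (fun t : ℝ => |σ + v| * (t + -C) + -C) atTop atTop :=
          tendsto_atTop_add_const_right _ _
            ((tendsto_atTop_add_const_right _ _ tendsto_id).const_mul_atTop (abs_pos.2 hσv))
        filter_upwards [eventually_ge_atTop b, h1.eventually_ge_atTop b] with t h2 h3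
        exact le_min h2 (by linarith)
      refine tendsto_atTop_mono (fun x => ?_) (hχlim.comp hlim')
      have hC0 : 0 ≤ C := (abs_nonneg _).trans (hC z (Finset.mem_insert_self _ _)).le
      simp only [Function.comp_apply]
      generalize φ (ψ x) = t
      rcases le_total (σ * t) C with h | h
      · have : max 0 (σ * t + -C) = 0 := max_eq_left (by linarith)
        simp [hχ, this]
      · have h1 : max 0 (σ * t + -C) = σ * t - C := by rw [max_eq_right (by linarith)]; ring
        have h2 : χ t = (σ + v) * (σ * t - C) + σ * C := by
          simp only [hχ, h1]; linear_combination (-t) * hσσ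
        have h3 : |t| = σ * t := by
          refine le_antisymm ?_ (hσa t)
          rcases hσ with rfl | rfl
          · rw [abs_of_nonneg (by linarith)]; linarith
          · rw [abs_of_nonpos (by linarith)]; linarith
        have h4 : |σ * C| = C := by
          rw [abs_mul, abs_of_nonneg hC0]
          rcases hσ with rfl | rfl <;> simp
        refine (min_le_right _ _).trans ?_
        rw [h2, h3]
        have h5 := abs_sub_abs_le_abs_sub ((σ + v) * (σ * t - C)) (-(σ * C))
        rw [abs_neg, h4, sub_neg_eq_add, abs_mul, abs_of_nonneg (by linarith : 0 ≤ σ * t - C)] at h5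
        linarith

/-- Clipping to `[-M, M]`. -/
theorem exists_clip {M : ℝ} (hM : 0 ≤ M) :
    ∃ φ, LineNet φ ∧ (∀ x, |φ x| ≤ M) ∧ ∀ x, |x| ≤ M → φ x = x := by
  -- The inner neuron takes the minimum with `M`, the outer one the maximum with `-M`.
  refine ⟨_, (neuron 1 (-1) (-M)).comp (neuron (-1) 1 (-M)), fun x => ?_, fun x hx => ?_⟩
  · rw [abs_le]
    constructor <;>
    rcases max_cases 0 (1 * x + -M) with ⟨h, h'⟩ | ⟨h, h'⟩ <;> rw [h] <;>
    [rcases max_cases 0 (-1 * (x + -1 * 0) + -M) with ⟨h, h''⟩ | ⟨h, h''⟩;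
     rcases max_cases 0 (-1 * (x + -1 * (1 * x + -M)) + -M) with ⟨h, h''⟩ | ⟨h, h''⟩;
     rcases max_cases 0 (-1 * (x + -1 * 0) + -M) with ⟨h, h''⟩ | ⟨h, h''⟩;
     rcases max_cases 0 (-1 * (x + -1 * (1 * x + -M)) + -M) with ⟨h, h''⟩ | ⟨h, h''⟩] <;>
    rw [h] <;> linarith
  · obtain ⟨h1, h2⟩ := abs_le.1 hx
    have h3 : max 0 (1 * x + -M) = 0 := max_eq_left (by linarith)
    have h4 : max 0 (-1 * x + -M) = 0 := max_eq_left (by linarith)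
    simp only [h3, mul_zero, add_zero, h4]

end LineNet

/-! ### Token-wise networks with a fixed linear mixing. -/

/-- Compositions of token-wise residual one-neuron ReLU layers and of the linear mixing layer which
adds to row `s₀` its average with weights `B` over the tokens. -/
inductive MixNet {d n : ℕ} (B : Fin n → Fin n → ℝ) (s₀ : Fin d) :
    ((Fin d → Fin n → ℝ) → Fin d → Fin n → ℝ) → Prop
  | id : MixNet B s₀ fun X => X
  | neuron {T : (Fin d → Fin n → ℝ) → Fin d → Fin n → ℝ} (hT : MixNet B s₀ T)
      (v u : Fin d → ℝ) (b : ℝ) (c : Fin d → ℝ) :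
      MixNet B s₀ fun X s i => T X s i + v s * max 0 (∑ t, u t * T X t i + b) + c s
  | mix {T : (Fin d → Fin n → ℝ) → Fin d → Fin n → ℝ} (hT : MixNet B s₀ T) :
      MixNet B s₀ fun X s i => T X s i + if s = s₀ then ∑ j, B i j * T X s₀ j else 0

namespace MixNet

variable {d n : ℕ} {B : Fin n → Fin n → ℝ} {s₀ : Fin d}
  {T S : (Fin d → Fin n → ℝ) → Fin d → Fin n → ℝ}

theorem congr (hT : MixNet B s₀ T) (h : ∀ X s i, S X s i = T X s i) : MixNet B s₀ S := by
  have : S = T := by funext X s i; exact h X s i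
  exact this ▸ hT

theorem comp (hS : MixNet B s₀ S) (hT : MixNet B s₀ T) : MixNet B s₀ fun X => S (T X) := by
  induction hS with
  | id => exact hT
  | neuron _ v u b c ih => exact ih.neuron v u b c
  | mix _ ih => exact ih.mix

theorem continuous (hT : MixNet B s₀ T) : Continuous T := by
  induction hT with
  | id => exact continuous_id
  | neuron _ v u b c ih => fun_prop
  | @mix T _ ih =>
    refine continuous_pi fun s => continuous_pi fun i => ?_
    by_cases hs : s = s₀
    · simp only [hs, if_true]; fun_prop
    · simp only [hs, if_false]; fun_prop

/-- A line network can be applied to a single row. -/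
theorem row {φ : ℝ → ℝ} (hφ : LineNet φ) (s₁ : Fin d) :
    MixNet B s₀ fun X s i => if s = s₁ then φ (X s i) else X s i := by
  induction hφ with
  | id => exact MixNet.id.congr fun X s i => by simp
  | @step φ _ v u b c ih =>
    refine (ih.neuron (Pi.single s₁ v) (Pi.single s₁ u) b (Pi.single s₁ c)).congr
      fun X s i => ?_
    have : ∑ t, (Pi.single s₁ u : Fin d → ℝ) t * (if t = s₁ then φ (X t i) else X t i)
        = u * φ (X s₁ i) := by
      rw [Finset.sum_eq_single s₁ (fun t _ ht => by simp [ht]) (by simp)]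
      simp
    simp only [this]
    by_cases hs : s = s₁
    · subst hs; simp
    · simp [hs]

theorem rows {φ : ℝ → ℝ} (hφ : LineNet φ) : MixNet B s₀ fun X s i => φ (X s i) := by
  have key : ∀ A : Finset (Fin d),
      MixNet B s₀ fun X s i => if s ∈ A then φ (X s i) else X s i := fun A => by
    induction A using Finset.induction_on with
    | empty => exact MixNet.id.congr fun X s i => by simp
    | insert s₁ A hs ih =>
      refine ((row hφ s₁).comp ih).congr fun X s i => ?_
      by_cases h : s = s₁
      · subst h; simp [hs]
      · simp [h]
  exact (key Finset.univ).congr fun X s i => by simp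

/-- The other rows can be shifted by prescribed functions of row `s₀` on a finite set. -/
theorem exists_fill (Z : Finset ℝ) (g : ℝ → Fin d → ℝ) (hg : ∀ z, g z s₀ = 0) :
    ∃ F : ℝ → Fin d → ℝ, (∀ x, F x s₀ = 0) ∧ (∀ z ∈ Z, F z = g z) ∧
      MixNet B s₀ fun X s i => X s i + F (X s₀ i) s := by
  induction Z using Finset.induction_on_max with
  | empty => exact ⟨0, by simp, by simp, MixNet.id.congr fun X s i => by simp⟩
  | insert z Z hz ih =>
    obtain ⟨F, hF0, hF, hN⟩ := ih
    obtain ⟨τ, hzτ, hτ⟩ : ∃ τ, τ < z ∧ ∀ x ∈ Z, x ≤ τ := by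
      rcases Z.eq_empty_or_nonempty with rfl | hne
      · exact ⟨z - 1, by linarith, by simp⟩
      · exact ⟨Z.max' hne, hz _ (Z.max'_mem hne), fun x hx => Z.le_max' x hx⟩
    have hzτ' : z - τ ≠ 0 := by linarith
    -- The kink `τ` lies between the old points and `z`, so the new neuron is silent on the former.
    -- It can still read row `s₀`, which `F` leaves unchanged.
    refine ⟨fun x s => F x s + (g z s - F z s) / (z - τ) * max 0 (x - τ), ?_, ?_, ?_⟩
    · intro x; simp [hF0, hg]
    · intro x hx
      funext s
      rcases Finset.mem_insert.1 hx with rfl | hx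
      · simp only [max_eq_right (by linarith : 0 ≤ x - τ)]
        field_simp
        ring
      · simp only [max_eq_left (by linarith [hτ x hx] : x - τ ≤ 0), hF x hx]
        ring
    · refine (hN.neuron (fun s => (g z s - F z s) / (z - τ)) (Pi.single s₀ 1) (-τ) 0).congr
        fun X s i => ?_
      have : ∑ t, (Pi.single s₀ 1 : Fin d → ℝ) t * (X t i + F (X s₀ i) t) = X s₀ i := by
        simp [Pi.single_apply, hF0]
      simp only [this, Pi.zero_apply]
      rw [← sub_eq_add_neg]
      ring

/-! ### Contextual codes and interpolation on finite sets of inputs. -/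

variable {ι : Type*} [Fintype ι]

/-- Row `s₀` can be made to determine the whole token. -/
theorem exists_shear (P : ι → Fin d → Fin n → ℝ) :
    ∃ T, MixNet B s₀ T ∧ ∀ κ κ' i i', T (P κ) s₀ i = T (P κ') s₀ i' →
      ∀ s, P κ s i = P κ' s i' := by
  let J := {a : (ι × Fin n) × (ι × Fin n) //
    (fun s => P a.1.1 s a.1.2 - P a.2.1 s a.2.2) ≠ 0}
  -- Some functional is nonzero on each of the finitely many nonzero token differences. Below, the
  -- bias `b` keeps the ReLU active on all data, so one neuron replaces row `s₀` by `θ` of the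
  -- token.
  obtain ⟨θ, hθ⟩ := Module.exists_dual_forall_apply_ne_zero (K := ℝ)
    (fun a : J => (fun s => P a.1.1.1 s a.1.1.2 - P a.1.2.1 s a.1.2.2)) fun a => a.2
  let u : Fin d → ℝ := fun s => θ (Pi.single s 1) - (Pi.single s₀ 1 : Fin d → ℝ) s
  have hu : ∀ x : Fin d → ℝ, x s₀ + ∑ t, u t * x t = θ x := fun x => by
    have : θ x = ∑ t, x t * θ (Pi.single t 1) := by
      rw [LinearMap.pi_apply_eq_sum_univ θ x]
      refine Finset.sum_congr rfl fun t _ => ?_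
      rw [smul_eq_mul]
      congr 2
      ext s
      simp [Pi.single_apply, eq_comm]
    rw [this]
    simp only [u, sub_mul, Finset.sum_sub_distrib, Pi.single_apply, ite_mul, one_mul, zero_mul,
      Finset.sum_ite_eq', Finset.mem_univ, if_true]
    rw [add_sub_cancel]
    exact Finset.sum_congr rfl fun t _ => mul_comm _ _
  obtain ⟨b, hb⟩ : ∃ b, ∀ κ i, 0 ≤ ∑ t, u t * P κ t i + b := by
    obtain ⟨b, hb⟩ := ((Finset.univ : Finset (ι × Fin n)).image
      fun a => -∑ t, u t * P a.1 t a.2).exists_le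
    exact ⟨b, fun κ i => by
      linarith [hb _ (Finset.mem_image_of_mem (fun a : ι × Fin n => -∑ t, u t * P a.1 t a.2)
        (Finset.mem_univ (κ, i)))]⟩
  refine ⟨_, MixNet.id.neuron (Pi.single s₀ 1) u b (Pi.single s₀ (-b)), fun κ κ' i i' h => ?_⟩
  have hval : ∀ κ i, P κ s₀ i + (Pi.single s₀ 1 : Fin d → ℝ) s₀ *
      max 0 (∑ t, u t * P κ t i + b) + (Pi.single s₀ (-b) : Fin d → ℝ) s₀
      = θ fun s => P κ s i := fun κ i => by
    rw [max_eq_right (hb κ i), ← hu]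
    simp
    ring
  rw [hval, hval] at h
  by_contra hne
  have hne' : (fun s => P κ s i - P κ' s i') ≠ 0 := fun h0 => hne fun s => by
    have := congrFun h0 s
    simp only [Pi.zero_apply] at this
    linarith
  refine hθ ⟨((κ, i), (κ', i')), hne'⟩ ?_
  change θ ((fun s => P κ s i) - fun s => P κ' s i') = 0
  rw [map_sub, h, sub_self]

/-- One mixing step, after a generic recoding of row `s₀`, makes each token remember its in-weights
neighbours. -/
theorem exists_mix_injective (hB0 : ∀ i j, 0 ≤ B i j) (hB1 : ∀ i j, B i j ≤ 1)
    (hBd : ∀ i, 0 < B i i) (V : ι → Fin d → Fin n → ℝ)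
    (hV : ∀ κ κ' i i', V κ s₀ i = V κ' s₀ i' → i = i') :
    ∃ T, MixNet B s₀ T ∧ ∀ κ κ' i i', T (V κ) s₀ i = T (V κ') s₀ i' →
      i = i' ∧ ∀ j, B i j ≠ 0 → V κ s₀ j = V κ' s₀ j := by
  classical
  let J := {a : (ι × Fin n) × (ι × Fin n) //
    ¬(a.1.2 = a.2.2 ∧ ∀ j, B a.1.2 j ≠ 0 → V a.1.1 s₀ j = V a.2.1 s₀ j)}
  -- The mixed code is linear in the recoding `c`. Hence a generic `c` separates all pairs whose
  -- functionals differ, and indicators of single code values show that they do.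
  let W : ι × Fin n → Module.Dual ℝ (ℝ → ℝ) := fun a =>
    LinearMap.proj (V a.1 s₀ a.2) + ∑ j, B a.2 j • LinearMap.proj (V a.1 s₀ j)
  have hW : ∀ κ i (c : ℝ → ℝ), W (κ, i) c = c (V κ s₀ i) + ∑ j, B i j * c (V κ s₀ j) :=
    fun κ i c => by simp [W, LinearMap.sum_apply]
  have hW1 : ∀ κ i κ' j, W (κ, i) (Pi.single (V κ' s₀ j) 1) =
      if V κ s₀ j = V κ' s₀ j then (if i = j then 1 else 0) + B i j else 0 := by
    intro κ i κ' j
    rw [hW]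
    have h1 : ∀ l, (Pi.single (V κ' s₀ j) 1 : ℝ → ℝ) (V κ s₀ l) =
        if l = j then (if V κ s₀ j = V κ' s₀ j then 1 else 0) else 0 := fun l => by
      rw [Pi.single_apply]
      by_cases hl : l = j
      · simp [hl]
      · rw [if_neg hl, if_neg fun h => hl (hV _ _ _ _ h)]
    simp only [h1, mul_ite, mul_zero, Finset.sum_ite_eq', Finset.mem_univ, if_true, mul_one]
    split_ifs <;> simp
  obtain ⟨c, hc⟩ := Module.Dual.exists_forall_ne_zero_of_forall_exists (K := ℝ)
    (fun a : J => W a.1.1 - W a.1.2) (by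
      rintro ⟨⟨⟨κ, i⟩, ⟨κ', i'⟩⟩, ha⟩
      by_cases hi : i = i'
      · subst hi
        simp only [true_and, not_forall] at ha
        obtain ⟨j, hj, hne⟩ := ha
        refine ⟨Pi.single (V κ s₀ j) 1, ?_⟩
        have hpos : 0 < B i j := lt_of_le_of_ne (hB0 i j) (Ne.symm hj)
        simp only [LinearMap.sub_apply, hW1, if_true, if_neg (Ne.symm hne), sub_zero]
        split_ifs <;> positivity
      · refine ⟨Pi.single (V κ s₀ i) 1, ?_⟩
        simp only [LinearMap.sub_apply, hW1, if_true, if_neg (Ne.symm hi)]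
        have h1 := hBd i
        have h2 := hB1 i' i
        split_ifs <;> [skip; skip] <;> linarith)
  obtain ⟨φ, hφ, hφc, -⟩ := LineNet.exists_interpolate
    ((Finset.univ : Finset (ι × Fin n)).image fun a => V a.1 s₀ a.2) c
  have hφV : ∀ κ i, φ (V κ s₀ i) = c (V κ s₀ i) := fun κ i =>
    hφc _ (Finset.mem_image_of_mem (fun a : ι × Fin n => V a.1 s₀ a.2) (Finset.mem_univ (κ, i)))
  refine ⟨_, (row hφ s₀).mix, fun κ κ' i i' h => ?_⟩
  by_contra hne
  refine hc ⟨((κ, i), (κ', i')), hne⟩ ?_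
  simp only [if_true, hφV, ← hW] at h
  rw [LinearMap.sub_apply, h, sub_self]

/-- `Reach R t i j`: there is an `R`-walk of length `t` from `i` to `j`. -/
def _root_.Diffuser.Reach (R : Fin n → Fin n → Prop) : ℕ → Fin n → Fin n → Prop
  | 0 => fun i j => i = j
  | t + 1 => fun i j => ∃ l, R i l ∧ Reach R t l j

/-- Self-loops lengthen walks at will, so the maximum of the finitely many lengths needed serves all
pairs. -/
theorem exists_reach {R : Fin n → Fin n → Prop} (hR : ∀ i, R i i)
    (hconn : ∀ i j, Relation.ReflTransGen R i j) : ∃ t, ∀ i j, Reach R t i j := by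
  have hmono : ∀ i j, Monotone fun t => Reach R t i j := fun i j =>
    monotone_nat_of_le_succ fun t h => ⟨i, hR i, h⟩
  have hex : ∀ a : Fin n × Fin n, ∃ t, Reach R t a.1 a.2 := fun ⟨i, j⟩ => by
    induction hconn i j using Relation.ReflTransGen.head_induction_on with
    | refl => exact ⟨0, rfl⟩
    | head h _ ih =>
      obtain ⟨t, ht⟩ := ih
      exact ⟨t + 1, _, h, ht⟩
  choose t ht using hex
  exact ⟨Finset.univ.sup t, fun i j =>
    hmono i j (Finset.le_sup (f := t) (Finset.mem_univ (i, j))) (ht (i, j))⟩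

/-- A contextual mapping: row `s₀` of each token determines the token and the whole input. -/
theorem exists_contextual (hB0 : ∀ i j, 0 ≤ B i j) (hB1 : ∀ i j, B i j ≤ 1)
    (hBd : ∀ i, 0 < B i i) (hconn : ∀ i j, Relation.ReflTransGen (fun i j => B i j ≠ 0) i j)
    (P : ι → Fin d → Fin n → ℝ) (hP : Function.Injective P)
    (hsep : ∀ κ κ' i i', (∀ s, P κ s i = P κ' s i') → i = i') :
    ∃ T, MixNet B s₀ T ∧ ∀ κ κ' i i', T (P κ) s₀ i = T (P κ') s₀ i' → i = i' ∧ κ = κ' := by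
  -- After `t` rounds the code knows its position and every token within `t` steps; each round adds
  -- the neighbours' knowledge.
  have key : ∀ t, ∃ T, MixNet B s₀ T ∧ ∀ κ κ' i i', T (P κ) s₀ i = T (P κ') s₀ i' →
      i = i' ∧ ∀ j, Reach (fun i j => B i j ≠ 0) t i j → ∀ s, P κ s j = P κ' s j := by
    intro t
    induction t with
    | zero =>
      obtain ⟨T, hT, h⟩ := exists_shear (B := B) (s₀ := s₀) P
      refine ⟨T, hT, fun κ κ' i i' he => ?_⟩
      obtain rfl := hsep κ κ' i i' (h κ κ' i i' he)
      refine ⟨rfl, ?_⟩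
      rintro j rfl
      exact h κ κ' i i he
    | succ t ih =>
      obtain ⟨T, hT, h⟩ := ih
      obtain ⟨S, hS, h'⟩ := exists_mix_injective (s₀ := s₀) hB0 hB1 hBd (fun κ => T (P κ))
        fun κ κ' i i' he => (h κ κ' i i' he).1
      refine ⟨_, hS.comp hT, fun κ κ' i i' he => ⟨(h' κ κ' i i' he).1, ?_⟩⟩
      rintro j ⟨l, hl, hlj⟩
      exact (h κ κ' l l ((h' κ κ' i i' he).2 l hl)).2 j hlj
  obtain ⟨t, ht⟩ := exists_reach (fun i => (hBd i).ne') hconn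
  obtain ⟨T, hT, h⟩ := key t
  refine ⟨T, hT, fun κ κ' i i' he => ⟨(h κ κ' i i' he).1, hP ?_⟩⟩
  funext s j
  exact (h κ κ' i i' he).2 j (ht i j) s

/-- Exact interpolation of arbitrary targets on a finite set of inputs. -/
theorem exists_interpolate (hB0 : ∀ i j, 0 ≤ B i j) (hB1 : ∀ i j, B i j ≤ 1)
    (hBd : ∀ i, 0 < B i i) (hconn : ∀ i j, Relation.ReflTransGen (fun i j => B i j ≠ 0) i j)
    (P : ι → Fin d → Fin n → ℝ) (hP : Function.Injective P)
    (hsep : ∀ κ κ' i i', (∀ s, P κ s i = P κ' s i') → i = i') (Y : ι → Fin d → Fin n → ℝ) :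
    ∃ T, MixNet B s₀ T ∧ ∀ κ, T (P κ) = Y κ := by
  classical
  obtain ⟨T, hT, hinj⟩ := exists_contextual (s₀ := s₀) hB0 hB1 hBd hconn P hP hsep
  let V : ι × Fin n → ℝ := fun a => T (P a.1) s₀ a.2
  have hVinj : Function.Injective V := fun a b hab => by
    obtain ⟨h1, h2⟩ := hinj _ _ _ _ hab
    exact Prod.ext h2 h1
  have hmem : ∀ a, V a ∈ Finset.univ.image V := fun a =>
    Finset.mem_image_of_mem V (Finset.mem_univ a)
  obtain ⟨F, hF0, hF, hFN⟩ := exists_fill (B := B) (s₀ := s₀) (Finset.univ.image V)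
    (fun z s => if s = s₀ then 0 else
      Function.extend V (fun a => Y a.1 s a.2 - T (P a.1) s a.2) 0 z) (fun z => by simp)
  obtain ⟨φ, hφ, hφV, -⟩ := LineNet.exists_interpolate (Finset.univ.image V)
    (Function.extend V (fun a => Y a.1 s₀ a.2) 0)
  -- Row `s₀` is overwritten last, since filling the other rows still reads the code in it.
  refine ⟨_, (row hφ s₀).comp (hFN.comp hT), fun κ => ?_⟩
  funext s i
  by_cases hs : s = s₀
  · subst hs
    simp only [if_true, hF0, add_zero]
    rw [hφV _ (hmem (κ, i)), hVinj.extend_apply]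
  · simp only [if_neg hs]
    rw [hF _ (hmem (κ, i))]
    simp only [if_neg hs]
    rw [hVinj.extend_apply]
    ring

end MixNet

/-! ### Uniform attention realizes the mixing layers. -/

section Realization

variable {n d : ℕ} (G : Digraph (Fin n)) (α : ℝ)

/-- The attention matrix of a head with zero query and key matrices. -/
def uniformAttention : Matrix (Fin n) (Fin n) ℝ :=
  open Classical in
  Matrix.of fun i j => if j ∈ neighbors G i then 1 / ((neighbors G i).card : ℝ) else 0

/-- The diffusion matrix after `k` steps of uniform attention. -/
def uniformDiffusion : ℕ → Matrix (Fin n) (Fin n) ℝ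
  | 0 => 1
  | k + 1 => (1 - α) • (uniformAttention G * uniformDiffusion k) + α • 1

variable {G α}

theorem uniformAttention_nonneg (i j : Fin n) : 0 ≤ uniformAttention G i j := by
  classical
  simp only [uniformAttention, Matrix.of_apply]
  split_ifs <;> positivity

theorem uniformAttention_pos {i j : Fin n} (hij : j ∈ neighbors G i) :
    0 < uniformAttention G i j := by
  have : 0 < (neighbors G i).card := Finset.card_pos.2 ⟨j, hij⟩
  simp only [uniformAttention, Matrix.of_apply, if_pos hij]
  positivity

theorem uniformAttention_sum (hG : ∀ k, k ∈ neighbors G k) (i : Fin n) :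
    ∑ j, uniformAttention G i j = 1 := by
  classical
  have : 0 < (neighbors G i).card := Finset.card_pos.2 ⟨i, hG i⟩
  simp only [uniformAttention, Matrix.of_apply, Finset.sum_ite_mem, Finset.univ_inter,
    Finset.sum_const, nsmul_eq_mul]
  field_simp

theorem uniformDiffusion_succ_apply (k : ℕ) (i j : Fin n) : uniformDiffusion G α (k + 1) i j =
    (1 - α) * ∑ l, uniformAttention G i l * uniformDiffusion G α k l j
      + α * if i = j then 1 else 0 := by
  simp [uniformDiffusion, Matrix.mul_apply, Matrix.one_apply]

theorem uniformDiffusion_nonneg (hα0 : 0 < α) (hα1 : α < 1) (k : ℕ) (i j : Fin n) :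
    0 ≤ uniformDiffusion G α k i j := by
  induction k generalizing i with
  | zero => simp only [uniformDiffusion, Matrix.one_apply]; split_ifs <;> norm_num
  | succ k ih =>
    rw [uniformDiffusion_succ_apply]
    have h1 : 0 ≤ ∑ l, uniformAttention G i l * uniformDiffusion G α k l j :=
      Finset.sum_nonneg fun l _ => mul_nonneg (uniformAttention_nonneg i l) (ih l)
    have h2 : 0 ≤ 1 - α := by linarith
    split_ifs <;> positivity

theorem uniformDiffusion_sum (hG : ∀ k, k ∈ neighbors G k) (k : ℕ) (i : Fin n) :
    ∑ j, uniformDiffusion G α k i j = 1 := by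
  induction k generalizing i with
  | zero => simp [uniformDiffusion, Matrix.one_apply]
  | succ k ih =>
    simp only [uniformDiffusion_succ_apply, Finset.sum_add_distrib, ← Finset.mul_sum]
    rw [Finset.sum_comm]
    simp only [← Finset.mul_sum, ih, mul_one, uniformAttention_sum hG]
    simp

theorem uniformDiffusion_le_one (hG : ∀ k, k ∈ neighbors G k) (hα0 : 0 < α) (hα1 : α < 1)
    (k : ℕ) (i j : Fin n) : uniformDiffusion G α k i j ≤ 1 := by
  rw [← uniformDiffusion_sum (α := α) hG k i]
  exact Finset.single_le_sum (f := fun j => uniformDiffusion G α k i j)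
    (fun j _ => uniformDiffusion_nonneg hα0 hα1 k i j) (Finset.mem_univ j)

/-- After at least one step the teleport term alone contributes `α` to the diagonal. -/
theorem uniformDiffusion_diag_pos (hα0 : 0 < α) (hα1 : α < 1) (k : ℕ) (i : Fin n) :
    0 < uniformDiffusion G α k i i := by
  cases k with
  | zero => simp [uniformDiffusion]
  | succ k =>
    rw [uniformDiffusion_succ_apply]
    have h1 : 0 ≤ ∑ l, uniformAttention G i l * uniformDiffusion G α k l i :=
      Finset.sum_nonneg fun l _ =>
        mul_nonneg (uniformAttention_nonneg i l) (uniformDiffusion_nonneg hα0 hα1 k l i)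
    have h2 : 0 ≤ 1 - α := by linarith
    simp only [if_true, mul_one]
    positivity

/-- One attention step from `i` to `j`, followed by remaining mass at `j`, has positive weight. -/
theorem uniformDiffusion_pos (hα0 : 0 < α) (hα1 : α < 1) {k : ℕ} (hk : 1 ≤ k) {i j : Fin n}
    (hij : j ∈ neighbors G i) : 0 < uniformDiffusion G α k i j := by
  obtain ⟨k, rfl⟩ := Nat.exists_eq_add_of_le' hk
  rw [uniformDiffusion_succ_apply]
  have h1 : 0 < ∑ l, uniformAttention G i l * uniformDiffusion G α k l j :=
    Finset.sum_pos' (fun l _ =>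
        mul_nonneg (uniformAttention_nonneg i l) (uniformDiffusion_nonneg hα0 hα1 k l j))
      ⟨j, Finset.mem_univ j,
        mul_pos (uniformAttention_pos hij) (uniformDiffusion_diag_pos hα0 hα1 k j)⟩
  have h2 : 0 < 1 - α := by linarith
  split_ifs <;> positivity

/-- A head with uniform attention whose values are the entries of row `s₀`. -/
def averagingHead (m : ℕ) (s₀ : Fin d) : HeadParams d m where
  WQ := 0
  WK := 0
  WV := Matrix.of fun _ s => if s = s₀ then 1 else 0

theorem averagingHead_attention (m : ℕ) (s₀ : Fin d) (X : Matrix (Fin d) (Fin n) ℝ) :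
    (averagingHead m s₀).attention G X = uniformAttention G := by
  ext i j
  simp [HeadParams.attention, averagingHead, uniformAttention]

theorem averagingHead_diffusion (m : ℕ) (s₀ : Fin d) (X : Matrix (Fin d) (Fin n) ℝ) (k : ℕ)
    (p : Fin m) (i : Fin n) : (averagingHead m s₀).diffusion G α X k p i =
      ∑ j, uniformDiffusion G α k i j * X s₀ j := by
  have hV : ∀ i, ((averagingHead m s₀).WV * X) p i = X s₀ i := fun i => by
    simp [averagingHead, Matrix.mul_apply]
  induction k generalizing i with
  | zero => simp [HeadParams.diffusion, hV, uniformDiffusion, Matrix.one_apply]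
  | succ k ih =>
    simp only [HeadParams.diffusion, averagingHead_attention, Matrix.add_apply, Matrix.smul_apply,
      Matrix.mul_apply, Matrix.transpose_apply, ih, smul_eq_mul, hV, uniformDiffusion_succ_apply,
      add_mul, Finset.sum_add_distrib]
    congr 1
    · simp only [mul_assoc, ← Finset.mul_sum, Finset.sum_mul]
      rw [Finset.sum_comm]
      congr 1
      exact Finset.sum_congr rfl fun l _ => Finset.sum_congr rfl fun j _ => by ring
    · simp

/-- Every `MixNet` with the uniform diffusion weights is a stack of Diffuser layers. -/
theorem MixNet.exists_layers {s₀ : Fin d} {K h m r : ℕ} (hh : 1 ≤ h) (hm : 1 ≤ m) (hr : 1 ≤ r)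
    {T : (Fin d → Fin n → ℝ) → Fin d → Fin n → ℝ} (hT : MixNet (uniformDiffusion G α K) s₀ T) :
    ∃ Ls : List (LayerParams d h m r), ∀ X s i, runLayers G α K Ls (Matrix.of X) s i = T X s i := by
  induction hT with
  | id => exact ⟨[], fun X s i => rfl⟩
  | @neuron T _ v u b c ih =>
    obtain ⟨Ls, hLs⟩ := ih
    -- A zero `WO` switches attention off, and only hidden unit 0 is fed back.
    let L : LayerParams d h m r :=
      { heads := fun _ => averagingHead m s₀
        WO := 0
        W1 := Matrix.of fun _ t => u t
        b1 := fun _ => b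
        W2 := Matrix.of fun s ρ => if ρ = ⟨0, hr⟩ then v s else 0
        b2 := c }
    refine ⟨Ls ++ [L], fun X s i => ?_⟩
    have : runLayers G α K Ls (Matrix.of X) = Matrix.of (T X) := by
      ext s i; exact hLs X s i
    simp only [runLayers] at this
    simp only [runLayers, List.foldl_append, this, List.foldl_cons, List.foldl_nil]
    simp [LayerParams.apply, LayerParams.attn, LayerParams.feedForward, L, Matrix.mul_apply]
  | @mix T _ ih =>
    obtain ⟨Ls, hLs⟩ := ih
    let L : LayerParams d h m r :=
      { heads := fun _ => averagingHead m s₀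
        WO := Matrix.of fun s p => if p = (⟨0, hh⟩, ⟨0, hm⟩) then (if s = s₀ then 1 else 0) else 0
        W1 := 0
        b1 := 0
        W2 := 0
        b2 := 0 }
    refine ⟨Ls ++ [L], fun X s i => ?_⟩
    have : runLayers G α K Ls (Matrix.of X) = Matrix.of (T X) := by
      ext s i; exact hLs X s i
    simp only [runLayers] at this
    simp only [runLayers, List.foldl_append, this, List.foldl_cons, List.foldl_nil]
    simp [LayerParams.apply, LayerParams.attn, LayerParams.feedForward, L, Matrix.mul_apply,
      averagingHead_diffusion]

end Realization

/-! ### Grid cells, error integrals and density. -/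

section Grid

variable {n d : ℕ}

/-- Points of a bounded set that lie near the upper end of a cell of a grid form a set of small
measure. -/
theorem exists_measure_grid_le {D : Set (Fin d → Fin n → ℝ)} (hDm : MeasurableSet D)
    (hD : volume D ≠ ⊤) (R w : ℝ) {ε : ENNReal} (hε : 0 < ε) :
    ∃ η : ℝ, 0 < η ∧ η < 1 ∧ ∃ A : Set (Fin d → Fin n → ℝ), MeasurableSet A ∧
      volume (D ∩ A) ≤ ε ∧ ∀ X ∉ A, ∀ s i, Int.fract ((X s i + R) / w) ≤ 1 - η := by
  let A : ℕ → Set (Fin d → Fin n → ℝ) := fun k =>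
    {X | ∃ s i, 1 - 1 / ((k : ℝ) + 2) < Int.fract ((X s i + R) / w)}
  have hA : ∀ k, MeasurableSet (A k) := fun k => by
    simp only [A, Set.ofPred_exists]
    refine MeasurableSet.iUnion fun s => MeasurableSet.iUnion fun i => ?_
    exact measurableSet_lt measurable_const (Measurable.fract (by fun_prop))
  have hanti : Antitone (fun k => D ∩ A k) := fun k l hkl X hX => by
    obtain ⟨hXD, s, i, h⟩ := hX
    refine ⟨hXD, s, i, lt_of_le_of_lt ?_ h⟩
    gcongr
  have hempty : ⋂ k, D ∩ A k = ∅ := by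
    rw [Set.eq_empty_iff_forall_notMem]
    intro X hX
    rw [Set.mem_iInter] at hX
    have hfin : ∀ a : Fin d × Fin n,
        ∀ᶠ k : ℕ in atTop, Int.fract ((X a.1 a.2 + R) / w) < 1 - 1 / ((k : ℝ) + 2) := fun a => by
      have h1 : Tendsto (fun k : ℕ => 1 - 1 / ((k : ℝ) + 2)) atTop (𝓝 (1 - 0)) := by
        refine tendsto_const_nhds.sub ?_
        exact tendsto_const_nhds.div_atTop
          (tendsto_atTop_add_const_right _ _ tendsto_natCast_atTop_atTop)
      exact h1.eventually_const_lt (by simpa using Int.fract_lt_one _)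
    obtain ⟨k, hk⟩ := (eventually_all.2 hfin).exists
    obtain ⟨-, s, i, h⟩ := hX k
    exact lt_asymm h (hk (s, i))
  -- Fractional parts are strictly below 1, so the bad sets decrease to the empty set; continuity
  -- from above applies as `D` has finite volume.
  have hlim := tendsto_measure_iInter_atTop (μ := volume) (fun k => (hDm.inter (hA k)).nullMeasurableSet) hanti
    ⟨0, ne_top_of_le_ne_top hD (measure_mono Set.inter_subset_left)⟩
  rw [hempty, measure_empty] at hlim
  obtain ⟨k, hk⟩ := (hlim.eventually_le_const hε).exists
  refine ⟨1 / ((k : ℝ) + 2), by positivity, ?_, A k, hA k, hk, fun X hX s i => ?_⟩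
  · rw [div_lt_one (by positivity)]
    have : (0 : ℝ) ≤ k := k.cast_nonneg
    linarith
  · by_contra hlt
    exact hX ⟨s, i, not_le.1 hlt⟩

end Grid

/-- A set integral is small if the integrand is small off a set of small measure. -/
theorem exists_lintegral_rpow_le {n d : ℕ} {D : Set (Fin d → Fin n → ℝ)} (hDm : MeasurableSet D)
    (hD : volume D ≠ ⊤) {q ε : ℝ} (hq : 1 ≤ q) (hε : 0 < ε) (C : ℝ) :
    ∃ ε₁ : ℝ, 0 < ε₁ ∧ ∃ ε₂ : ENNReal, 0 < ε₂ ∧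
      ∀ (A : Set (Fin d → Fin n → ℝ)) (u : (Fin d → Fin n → ℝ) → Fin d → Fin n → ℝ),
        MeasurableSet A → volume (D ∩ A) ≤ ε₂ → (∀ X ∈ D, ∀ s i, |u X s i| ≤ C) →
        (∀ X ∈ D, X ∉ A → ∀ s i, |u X s i| ≤ ε₁) →
        (∫⁻ X in D, ∑ s, ∑ i, ENNReal.ofReal (|u X s i| ^ q)) ^ (1 / q) ≤ ENNReal.ofReal ε := by
  have hq0 : 0 < q := by linarith
  let a : ℝ := volume.real D * (d * n)
  have ha : 0 ≤ a := by positivity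
  let b : ℝ := d * n * |C| ^ q
  have hb : 0 ≤ b := by positivity
  -- Each of the two regions gets half of `ε ^ q`; the `+ 1` covers a vanishing `a` or `b`.
  let t : ℝ := ε ^ q / (2 * (a + 1))
  have ht : 0 < t := by positivity
  let τ : ℝ := ε ^ q / (2 * (b + 1))
  have hτ : 0 < τ := by positivity
  refine ⟨t ^ (1 / q), by positivity, ENNReal.ofReal τ, by simpa using hτ, ?_⟩
  intro A u hA hvol hC hsmall
  have hsum : ∀ (X : Fin d → Fin n → ℝ) (e : ℝ), (∀ s i, |u X s i| ≤ e) →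
      ∑ s, ∑ i, ENNReal.ofReal (|u X s i| ^ q) ≤ ENNReal.ofReal (d * n * |e| ^ q) := by
    intro X e he
    calc ∑ s, ∑ i, ENNReal.ofReal (|u X s i| ^ q)
        ≤ ∑ _s : Fin d, ∑ _i : Fin n, ENNReal.ofReal (|e| ^ q) := by
          refine Finset.sum_le_sum fun s _ => Finset.sum_le_sum fun i _ => ?_
          refine ENNReal.ofReal_le_ofReal (Real.rpow_le_rpow (abs_nonneg _) ?_ hq0.le)
          exact (he s i).trans (le_abs_self e)
      _ = ENNReal.ofReal (d * n * |e| ^ q) := by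
          rw [ENNReal.ofReal_mul (by positivity), ENNReal.ofReal_mul (by positivity)]
          simp [mul_assoc]
  have h1 : ∫⁻ X in D ∩ A, ∑ s, ∑ i, ENNReal.ofReal (|u X s i| ^ q)
      ≤ ENNReal.ofReal (ε ^ q / 2) := by
    calc _ ≤ ∫⁻ _ in D ∩ A, ENNReal.ofReal b :=
          setLIntegral_mono' (hDm.inter hA) fun X hX => hsum X C (hC X hX.1)
      _ = ENNReal.ofReal b * volume (D ∩ A) := by simp
      _ ≤ ENNReal.ofReal b * ENNReal.ofReal τ := by gcongr
      _ = ENNReal.ofReal (b * τ) := (ENNReal.ofReal_mul hb).symm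
      _ ≤ ENNReal.ofReal (ε ^ q / 2) := by
          refine ENNReal.ofReal_le_ofReal ?_
          have : (b + 1) * τ = ε ^ q / 2 := by simp only [τ]; field_simp
          linarith
  have h2 : ∫⁻ X in D \ A, ∑ s, ∑ i, ENNReal.ofReal (|u X s i| ^ q)
      ≤ ENNReal.ofReal (ε ^ q / 2) := by
    have htq : |t ^ (1 / q)| ^ q = t := by
      rw [abs_of_nonneg (by positivity), ← Real.rpow_mul ht.le, one_div_mul_cancel hq0.ne',
        Real.rpow_one]
    calc _ ≤ ∫⁻ _ in D \ A, ENNReal.ofReal (d * n * t) :=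
          setLIntegral_mono' (hDm.diff hA) fun X hX => by
            have := hsum X _ (hsmall X hX.1 hX.2)
            rwa [htq] at this
      _ = ENNReal.ofReal (d * n * t) * volume (D \ A) := by simp
      _ ≤ ENNReal.ofReal (d * n * t) * volume D := by gcongr; exact Set.sdiff_subset
      _ = ENNReal.ofReal (a * t) := by
          rw [← ofReal_measureReal hD, ← ENNReal.ofReal_mul (by positivity)]
          congr 1
          simp only [a]
          ring
      _ ≤ ENNReal.ofReal (ε ^ q / 2) := by
          refine ENNReal.ofReal_le_ofReal ?_
          have : (a + 1) * t = ε ^ q / 2 := by simp only [t]; field_simp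
          linarith
  have h3 : ∫⁻ X in D, ∑ s, ∑ i, ENNReal.ofReal (|u X s i| ^ q) ≤ ENNReal.ofReal (ε ^ q) := by
    calc _ = ∫⁻ X in (D ∩ A) ∪ (D \ A), ∑ s, ∑ i, ENNReal.ofReal (|u X s i| ^ q) := by
          rw [Set.inter_union_sdiff]
      _ ≤ _ := lintegral_union_le _ _ _
      _ ≤ ENNReal.ofReal (ε ^ q / 2) + ENNReal.ofReal (ε ^ q / 2) := add_le_add h1 h2
      _ = ENNReal.ofReal (ε ^ q) := by
          rw [← ENNReal.ofReal_add (by positivity) (by positivity), add_halves]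
  calc _ ≤ ENNReal.ofReal (ε ^ q) ^ (1 / q) := ENNReal.rpow_le_rpow h3 (by positivity)
    _ = ENNReal.ofReal ε := by
        rw [ENNReal.ofReal_rpow_of_nonneg (by positivity) (by positivity), ← Real.rpow_mul hε.le,
          mul_one_div_cancel hq0.ne', Real.rpow_one]

/-- `MixNet`s with a positional embedding are dense in `L^q` on compact sets. -/
theorem MixNet.exists_approx {n d : ℕ} {B : Fin n → Fin n → ℝ} {s₀ : Fin d}
    (hB0 : ∀ i j, 0 ≤ B i j) (hB1 : ∀ i j, B i j ≤ 1)
    (hBd : ∀ i, 0 < B i i) (hconn : ∀ i j, Relation.ReflTransGen (fun i j => B i j ≠ 0) i j)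
    {D : Set (Fin d → Fin n → ℝ)} (hD : IsCompact D)
    {f : (Fin d → Fin n → ℝ) → Fin d → Fin n → ℝ} (hf : ContinuousOn f D)
    {q ε : ℝ} (hq : 1 ≤ q) (hε : 0 < ε) :
    ∃ (E : Fin d → Fin n → ℝ) (T : (Fin d → Fin n → ℝ) → Fin d → Fin n → ℝ), MixNet B s₀ T ∧
      (∫⁻ X in D, ∑ s, ∑ i, ENNReal.ofReal (|f X s i - T (X + E) s i| ^ q)) ^ (1 / q)
        ≤ ENNReal.ofReal ε := by
  classical
  have hent : ∀ (X : Fin d → Fin n → ℝ) s i, |X s i| ≤ ‖X‖ := fun X s i =>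
    (norm_le_pi_norm (X s) i).trans (norm_le_pi_norm X s)
  obtain ⟨R, hR0, hR⟩ : ∃ R : ℝ, 0 < R ∧ ∀ X ∈ D, ∀ s i, |X s i| < R := by
    obtain ⟨R, hR0, hR⟩ := hD.isBounded.exists_pos_norm_lt
    exact ⟨R, hR0, fun X hX s i => (hent X s i).trans_lt (hR X hX)⟩
  obtain ⟨M, hM0, hM⟩ : ∃ M : ℝ, 0 ≤ M ∧ ∀ X ∈ D, ∀ s i, |f X s i| ≤ M := by
    obtain ⟨M, hM0, hM⟩ := (hD.image_of_continuousOn hf).isBounded.exists_pos_norm_le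
    exact ⟨M, hM0.le, fun X hX s i =>
      (hent (f X) s i).trans (hM _ (Set.mem_image_of_mem f hX))⟩
  obtain ⟨ε₁, hε₁, ε₂, hε₂, hint⟩ :=
    exists_lintegral_rpow_le hD.measurableSet hD.measure_lt_top.ne hq hε (2 * M)
  obtain ⟨ω, hω, hunif⟩ := Metric.uniformContinuousOn_iff.1
    (hD.uniformContinuousOn_of_continuous hf) (ε₁ / 2) (by positivity)
  obtain ⟨N, hN⟩ := exists_nat_gt (2 * R / ω)
  have hN0 : (0 : ℝ) < N := lt_of_le_of_lt (by positivity) hN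
  obtain ⟨w, hw⟩ : ∃ w, w = 2 * R / N := ⟨_, rfl⟩
  have hw0 : 0 < w := by rw [hw]; positivity
  have hwω : w < ω := by
    rw [hw, div_lt_iff₀ hN0]
    rw [div_lt_iff₀ hω] at hN
    linarith
  have hNw : N * w = 2 * R := by rw [hw]; field_simp
  obtain ⟨η, hη0, hη1, A, hA, hAvol, hAc⟩ :=
    exists_measure_grid_le hD.measurableSet hD.measure_lt_top.ne R w hε₂
  -- the cell of an entry
  have hcell : ∀ X ∈ D, ∀ s i, 0 ≤ (X s i + R) / w ∧ (X s i + R) / w < N := by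
    intro X hX s i
    have := abs_lt.1 (hR X hX s i)
    refine ⟨div_nonneg (by linarith) hw0.le, ?_⟩
    rw [div_lt_iff₀ hw0, hNw]
    linarith
  have hfloor : ∀ X ∈ D, ∀ s i, (X s i + R) =
      ⌊(X s i + R) / w⌋₊ * w + Int.fract ((X s i + R) / w) * w := by
    intro X hX s i
    rw [← add_mul, natCast_floor_eq_intCast_floor (hcell X hX s i).1, Int.floor_add_fract]
    field_simp
  -- Since `N * w = 2 * R`, the embedding `R + N * w * i` puts token `i` into the `i`-th block of
  -- `N` cells. The corners of different tokens are therefore distinct.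
  let P : (Fin d → Fin n → Fin N) → Fin d → Fin n → ℝ := fun κ s i =>
    ((κ s i + N * i : ℕ) : ℝ) * w
  have hPval : ∀ κ κ' s i i', P κ s i = P κ' s i' → (κ s i + N * i : ℕ) = κ' s i' + N * i' :=
    fun κ κ' s i i' h => by exact_mod_cast mul_right_cancel₀ hw0.ne' h
  have hPinj : Function.Injective P := fun κ κ' h => by
    funext s i
    have := hPval κ κ' s i i (congrFun (congrFun h s) i)
    exact Fin.ext (by omega)
  have hPsep : ∀ κ κ' i i', (∀ s, P κ s i = P κ' s i') → i = i' := fun κ κ' i i' h => by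
    have h1 := congrArg (· / N) (hPval κ κ' s₀ i i' (h s₀))
    have hNpos : 0 < N := by exact_mod_cast hN0
    simp only [Nat.add_mul_div_left _ _ hNpos, Nat.div_eq_of_lt (κ s₀ i).2,
      Nat.div_eq_of_lt (κ' s₀ i').2, zero_add] at h1
    exact Fin.ext h1
  -- The target is a value of `f` at some point of `D` in the cell, with default 0 for cells missing
  -- `D`.
  let Y : (Fin d → Fin n → Fin N) → Fin d → Fin n → ℝ := fun κ =>
    if h : ∃ X ∈ D, ∀ s i, ⌊(X s i + R) / w⌋₊ = κ s i then f h.choose else 0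
  have hYM : ∀ κ s i, |Y κ s i| ≤ M := fun κ s i => by
    simp only [Y]
    split_ifs with h
    · exact hM _ h.choose_spec.1 s i
    · simpa using hM0
  have hYf : ∀ κ, ∀ X ∈ D, (∀ s i, ⌊(X s i + R) / w⌋₊ = κ s i) → ∀ s i,
      |f X s i - Y κ s i| ≤ ε₁ / 2 := by
    intro κ X hX hκ s i
    have h : ∃ X ∈ D, ∀ s i, ⌊(X s i + R) / w⌋₊ = κ s i := ⟨X, hX, hκ⟩
    simp only [Y, dif_pos h]
    obtain ⟨hX', hκ'⟩ := h.choose_spec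
    generalize h.choose = X' at hX' hκ'
    have hd : Dist.dist X X' < ω := by
      refine lt_of_le_of_lt ?_ hwω
      refine (dist_pi_le_iff hw0.le).2 fun s => (dist_pi_le_iff hw0.le).2 fun i => ?_
      have h1 := hfloor X hX s i
      have h2 := hfloor X' hX' s i
      rw [hκ] at h1
      rw [hκ'] at h2
      have h3 := Int.fract_nonneg ((X s i + R) / w)
      have h4 := (Int.fract_lt_one ((X s i + R) / w)).le
      have h5 := Int.fract_nonneg ((X' s i + R) / w)
      have h6 := (Int.fract_lt_one ((X' s i + R) / w)).le
      rw [Real.dist_eq, abs_le]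
      constructor <;> nlinarith
    have h7 := hunif X hX X' hX' hd
    rw [dist_eq_norm] at h7
    exact (hent (f X - f X') s i).trans h7.le
  obtain ⟨T₂, hT₂, hT₂P⟩ := exists_interpolate (s₀ := s₀) hB0 hB1 hBd hconn P hPinj hPsep Y
  obtain ⟨χ, hχ, hχM, hχid⟩ := LineNet.exists_clip hM0
  let T₃ : (Fin d → Fin n → ℝ) → Fin d → Fin n → ℝ := fun X s i => χ (T₂ X s i)
  have hT₃ : MixNet B s₀ T₃ := (rows hχ).comp hT₂
  have hT₃P : ∀ κ, T₃ (P κ) = Y κ := fun κ => by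
    funext s i
    simp only [T₃, hT₂P]
    exact hχid _ (hYM κ s i)
  have hnear : ∀ κ, ∀ᶠ v in 𝓝 (0 : Fin d → Fin n → ℝ),
      Dist.dist (T₃ (P κ + v)) (Y κ) < ε₁ / 2 := fun κ => by
    have h1 : Tendsto (fun v => T₃ (P κ + v)) (𝓝 0) (𝓝 (Y κ)) := by
      have h2 : Continuous fun v => T₃ (P κ + v) := hT₃.continuous.comp (by fun_prop)
      simpa [hT₃P] using h2.tendsto 0
    exact (Metric.tendsto_nhds.1 h1) _ (by positivity)
  -- Contraction reaches the corners only approximately; continuity of `T₃` gives one tolerance for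
  -- all finitely many cells.
  obtain ⟨δ, hδ, hnear'⟩ := Metric.eventually_nhds_iff.1 (eventually_all.2 hnear)
  have hl0 : 0 < (1 - η) * w := mul_pos (by linarith) hw0
  have hlw : (1 - η) * w < w := by nlinarith
  obtain ⟨φ, hφ, -, hφc⟩ := LineNet.exists_contract hl0 hlw (half_pos hδ) (N * n)
  refine ⟨fun _ i => R + N * w * (i : ℕ), _, hT₃.comp (rows hφ), ?_⟩
  refine hint A _ hA hAvol (fun X hX s i => ?_) (fun X hX hXA s i => ?_)
  · refine (abs_sub _ _).trans ?_
    have h1 := hM X hX s i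
    exact (add_le_add h1 (hχM _)).trans (two_mul M).ge
  · let κ : Fin d → Fin n → Fin N := fun s i =>
      ⟨⌊(X s i + R) / w⌋₊, (Nat.floor_lt (hcell X hX s i).1).2 (hcell X hX s i).2⟩
    have h1 := hYf κ X hX (fun s i => rfl) s i
    have hφP : ∀ s i, |φ (X s i + (R + N * w * (i : ℕ))) - P κ s i| ≤ δ / 2 := by
      intro s i
      have hlt : (κ s i + N * i : ℕ) < N * n := by
        have h2 := (κ s i).2
        have h3 : N * ((i : ℕ) + 1) ≤ N * n := Nat.mul_le_mul_left N i.2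
        rw [Nat.mul_add, Nat.mul_one] at h3
        omega
      have h4 : X s i + (R + N * w * (i : ℕ)) =
          P κ s i + Int.fract ((X s i + R) / w) * w := by
        have := hfloor X hX s i
        simp only [P, κ]
        push_cast
        linear_combination this
      have h5 := Int.fract_nonneg ((X s i + R) / w)
      have h6 := hAc X hXA s i
      refine hφc _ hlt _ ?_ ?_
      · rw [h4]
        exact le_add_of_nonneg_right (mul_nonneg h5 hw0.le)
      · rw [h4]
        exact add_le_add_right (mul_le_mul_of_nonneg_right h6 hw0.le) _
    let v : Fin d → Fin n → ℝ := (fun s i => φ (X s i + (R + N * w * (i : ℕ)))) - P κ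
    have hv : Dist.dist v 0 < δ := by
      refine lt_of_le_of_lt ?_ (half_lt_self hδ)
      refine (dist_pi_le_iff (by positivity)).2 fun s =>
        (dist_pi_le_iff (by positivity)).2 fun i => ?_
      rw [Real.dist_eq, Pi.zero_apply, Pi.zero_apply, sub_zero]
      exact hφP s i
    have h2 := hnear' hv κ
    have hPv : P κ + v = fun s i => φ (X s i + (R + N * w * (i : ℕ))) := add_sub_cancel _ _
    rw [hPv, dist_eq_norm] at h2
    have h3 := (hent _ s i).trans h2.le
    rw [Pi.sub_apply, Pi.sub_apply, abs_sub_comm] at h3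
    refine (abs_sub_le _ (Y κ s i) _).trans ?_
    simp only [Pi.add_apply]
    linarith

end Diffuser

end

theorem theorem1 {n d : ℕ} (G : Digraph (Fin n)) (hG : Diffuser.SparsityCondition G)
    (α : ℝ) (hα0 : 0 < α) (hα1 : α < 1) (K : ℕ) (hK : 1 ≤ K)
    (h m r : ℕ) (hh : 1 ≤ h) (hm : 1 ≤ m) (hr : 1 ≤ r)
    (D : Set (Matrix (Fin d) (Fin n) ℝ)) (hD : IsCompact D)
    (f : Matrix (Fin d) (Fin n) ℝ → Matrix (Fin d) (Fin n) ℝ) (hf : ContinuousOn f D)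
    (q : ℝ) (hq : 1 ≤ q) (ε : ℝ) (hε : 0 < ε) :
    ∃ g ∈ Diffuser.networks G α K d h m r, Diffuser.dist D q f g ≤ ENNReal.ofReal ε := by
  rcases Nat.eq_zero_or_pos d with rfl | hd
  -- For `d = 0` there is no row to serve as `s₀`, but the integrand is an empty sum.
  · refine ⟨_, ⟨0, [], fun X => rfl⟩, ?_⟩
    have : (0 : ℝ) < q⁻¹ := by positivity
    simp [Diffuser.dist, this]
  · obtain ⟨E, T, hT, hle⟩ := Diffuser.MixNet.exists_approx (s₀ := (⟨0, hd⟩ : Fin d))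
      (B := Diffuser.uniformDiffusion G α K)
      (Diffuser.uniformDiffusion_nonneg hα0 hα1 K)
      (Diffuser.uniformDiffusion_le_one hG.self_attends hα0 hα1 K)
      (Diffuser.uniformDiffusion_diag_pos hα0 hα1 K)
      (fun i j => Relation.ReflTransGen.mono (fun a b hab =>
        (Diffuser.uniformDiffusion_pos hα0 hα1 hK (by simpa [Diffuser.neighbors] using hab)).ne') _ _
        (hG.connected i j))
      (D := Matrix.of ⁻¹' D) hD (f := fun X => f (Matrix.of X)) hf hq hε
    obtain ⟨Ls, hLs⟩ := hT.exists_layers hh hm hr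
    refine ⟨_, ⟨Matrix.of E, Ls, fun X => rfl⟩, ?_⟩
    have hrun : ∀ (X : Fin d → Fin n → ℝ) s i,
        Diffuser.runLayers G α K Ls (Matrix.of X + Matrix.of E) s i = T (X + E) s i :=
      fun X s i => hLs (X + E) s i
    simp only [Diffuser.dist, hrun]
    exact hle
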